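/- Let $G$ be a finite simple graph on the vertex set $V$, let $K$ be a field, let $S=K[V]$ be the polynomial ring whose variables are the vertices of $G$, with its standard $\mathbb{N}^{V}$-grading, and let $I(G)=(uv : \{u,v\}\in E(G))\subset S$ be the edge ideal of $G$. For $\tau\in\mathbb{N}^V$, let $\beta_{i,\tau}(S/I(G))$ denote the number of summands $S(-\tau)$ in homological degree $i$ of a minimal $\mathbb{N}^V$-graded free resolution of $S/I(G)$. Two edges $e,e'$ of $G$ are called $3$-disjoint in $G$ if $e\cap e'=\emptyset$ and the subgraph of $G$ induced on $e\cup e'$ has edge set $\{e,e'\}$. Let $r\ge 1$, and let $B_1,\dots,B_r$ be complete bipartite subgraphs of $G$ (not necessarily induced) such that 1. $V(B_k)\cap V(B_\ell)=\emptyset$ for all $k\ne\ell$; 2. there exist edges $e_k\in E(B_k)$, $k=1,\dots,r$, such that $e_k$ and $e_\ell$ are $3$-disjoint in $G$ for all $k\neq\ell$. Set $\sigma=V(B_1)\cup\dots\cup V(B_r)$, and identify $\sigma$ with the $(0,1)$-vector in $\mathbb{N}^V$ whose $v$-th entry is $1$ if and only if $v\in\sigma$. Then $$\beta_{|\sigma|-r,\,\sigma}(S/I(G))\neq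 0 .$$ -/

import Mathlib

namespace BettiEdgeIdeal

open MvPolynomial

universe u v w

/-! ### Graphs -/

section Graphs

variable {V : Type u} {G : SimpleGraph V}

/-- A subgraph `B` of `G` is a complete bipartite graph: its vertex set is a disjoint union of
two parts `V₁`, `V₂`, and its edges are exactly the pairs with one end in each part. `B` need
not be an induced subgraph of `G`. -/
def IsCompleteBipartiteSubgraph (B : G.Subgraph) : Prop :=
  ∃ V₁ V₂ : Set V, Disjoint V₁ V₂ ∧ V₁ ∪ V₂ = B.verts ∧
    ∀ a b : V, B.Adj a b ↔ (a ∈ V₁ ∧ b ∈ V₂) ∨ (a ∈ V₂ ∧ b ∈ V₁)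

/-- Two edges are 3-disjoint in `G`: they have no common vertex, and the subgraph of `G` induced
on the union of their vertex sets has no edges besides these two. -/
def ThreeDisjoint (G : SimpleGraph V) (e₁ e₂ : Sym2 V) : Prop :=
  Disjoint (e₁ : Set V) (e₂ : Set V) ∧
    ((⊤ : G.Subgraph).induce ((e₁ : Set V) ∪ (e₂ : Set V))).edgeSet = {e₁, e₂}

/-- The edge ideal `I(G) = (u v : {u, v} ∈ E(G))` in the polynomial ring `K[V]`. -/
noncomputable def edgeIdeal (K : Type v) [Field K] (G : SimpleGraph V) : Ideal (MvPolynomial V K) :=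
  Ideal.span {f | ∃ a b : V, G.Adj a b ∧ f = X a * X b}

/-- The `(0,1)`-vector of a set of vertices. -/
noncomputable def zeroOneVector (σ : Finset V) : V →₀ ℕ :=
  ∑ a ∈ σ, Finsupp.single a 1

end Graphs

/-! ### Multigraded resolutions and Betti numbers -/

section Resolutions

variable {V : Type u} {K : Type v} [Field K]

/-- The degree `σ` part of the quotient `S / I`, for the fine grading of `S = K[V]`: the image of
the degree `σ` part `K · x^σ` of `S`. -/
noncomputable def quotientDegreePart (I : Ideal (MvPolynomial V K)) (σ : V →₀ ℕ) :
    Submodule K (MvPolynomial V K ⧸ I) :=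
  (LinearMap.range (monomial σ : K →ₗ[K] MvPolynomial V K)).map
    (Ideal.Quotient.mkₐ K I).toLinearMap

/-- An element of the free module `⨁ b, S(-δ b)` is homogeneous of degree `σ`: each monomial
`x^m` occurring in the coordinate `b` satisfies `m + δ b = σ`. -/
def IsHomogeneousOfDegree {n : ℕ} (δ : Fin n → V →₀ ℕ) (σ : V →₀ ℕ)
    (x : Fin n → MvPolynomial V K) : Prop :=
  ∀ (b : Fin n) (m : V →₀ ℕ), coeff m (x b) ≠ 0 → m + δ b = σ

/-- A minimal multigraded free resolution
`⋯ → F 2 → F 1 → F 0 → M → 0` (by modules of finite rank) of a module `M` over `S = K[V]` that is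
graded by its subspaces `𝓜 σ`. Here `F i = ⨁ b : Fin (rank i), S(-(degree i b))`. -/
structure MinimalFreeResolution {M : Type w} [AddCommGroup M] [Module K M]
    [Module (MvPolynomial V K) M] [IsScalarTower K (MvPolynomial V K) M] (𝓜 : (V →₀ ℕ) → Submodule K M) where
  /-- the rank of `F i` -/
  rank : ℕ → ℕ
  /-- the multidegrees of the basis elements of `F i` -/
  degree : (i : ℕ) → Fin (rank i) → V →₀ ℕ
  /-- the differential `F (i + 1) → F i` -/
  d : (i : ℕ) → (Fin (rank (i + 1)) → MvPolynomial V K) →ₗ[MvPolynomial V K]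
    (Fin (rank i) → MvPolynomial V K)
  /-- the augmentation `F 0 → M` -/
  aug : (Fin (rank 0) → MvPolynomial V K) →ₗ[MvPolynomial V K] M
  d_homogeneous : ∀ (i : ℕ) (σ : V →₀ ℕ) (x : Fin (rank (i + 1)) → MvPolynomial V K),
    IsHomogeneousOfDegree (degree (i + 1)) σ x → IsHomogeneousOfDegree (degree i) σ (d i x)
  aug_homogeneous : ∀ (σ : V →₀ ℕ) (x : Fin (rank 0) → MvPolynomial V K),
    IsHomogeneousOfDegree (degree 0) σ x → aug x ∈ 𝓜 σ
  aug_surjective : Function.Surjective aug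
  exact_aug : Function.Exact (d 0) aug
  exact_d : ∀ i : ℕ, Function.Exact (d (i + 1)) (d i)
  /-- minimality: the image of each differential lies in `𝔪 F`, where `𝔪 = (x_a : a ∈ V)` -/
  minimal : ∀ (i : ℕ) (x : Fin (rank (i + 1)) → MvPolynomial V K) (b : Fin (rank i)),
    d i x b ∈ Ideal.span (Set.range (X : V → MvPolynomial V K))

/-- The number of summands `S(-σ)` in the `i`-th module of a minimal multigraded free
resolution. -/
noncomputable def MinimalFreeResolution.multiplicity {M : Type w} [AddCommGroup M] [Module K M]
    [Module (MvPolynomial V K) M] [IsScalarTower K (MvPolynomial V K) M] {𝓜 : (V →₀ ℕ) → Submodule K M}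
    (R : MinimalFreeResolution 𝓜) (i : ℕ) (σ : V →₀ ℕ) : ℕ :=
  Nat.card {b : Fin (R.rank i) // R.degree i b = σ}

open Classical in
/-- The multigraded Betti number `β_{i,σ}(M)`: the number of summands `S(-σ)` in the `i`-th module
of a minimal multigraded free resolution of `M`. Such a resolution is unique up to isomorphism,
so the choice is immaterial; the value is `0` by convention for modules that have none. -/
noncomputable def multigradedBetti {M : Type w} [AddCommGroup M] [Module K M]
    [Module (MvPolynomial V K) M] [IsScalarTower K (MvPolynomial V K) M] (𝓜 : (V →₀ ℕ) → Submodule K M) (i : ℕ) (σ : V →₀ ℕ) : ℕ :=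
  if h : Nonempty (MinimalFreeResolution 𝓜) then h.some.multiplicity i σ else 0

end Resolutions

end BettiEdgeIdeal

/-!
The argument has two independent halves.

*Resolutions exist.* The edge ideal is closed under passing to homogeneous components, so by
Noetherianity its syzygy modules have finite homogeneous generating systems. A system with the
fewest members has no relation with a unit coefficient (`IsHomogeneousGenerators.relation_mem`),
so iterating this choice gives a minimal resolution (`nonempty_minimalFreeResolution`). Hence
`multigradedBetti` is the multiplicity in an actual resolution.

*Every resolution `F` has a summand `S(-σ)` in degree `|σ| - r`.* The strand of degree `σ` of the
Koszul complex with coefficients in `S / I(G)` is, up to a shift, the cochain complex of the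
independence complex `Δ` of `G` restricted to `σ`: a subset `W` of `σ` indexes the monomial `x^W`.
With coefficients in `S(-δ)` the strand is contractible in the direction of any vertex of `σ` that
`δ` does not involve, so it has homology only for `δ = σ`, at `W = σ`
(`exists_koszulD_eq`). A chase in the double complex `F ⊗ Koszul` (`MinimalFreeResolution.zigzag`)
therefore shows that, if `F` has no generator of degree `σ` in homological degree `|σ| - r`,
each cocycle on the faces of `Δ` with `r` elements is a coboundary; this is the form of Hochster's
formula stated in `MinimalFreeResolution.exists_degree_eq`.

It remains to find a nontrivial cocycle. As the edges `e k = {a k, b k}` are pairwise 3-disjoint,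
`Δ` contains the boundary of the cross-polytope with antipodal pairs `a k`, `b k`. An independent
set meets each `V(B k)` within one of the two parts of `B k`, so mapping the part of `a k` to `a k`
and that of `b k` to `b k` is a simplicial retraction of `Δ` onto this `(r - 1)`-sphere. Pulling
back the cochain that is `1` on the facet `{a 1, …, a r}` gives `transversalCochain`. It is a
cocycle (`koszulD_transversalCochain`) whose value on the fundamental cycle of the sphere is `1`
(`exists_transversalCochain_ne`). The vertices are ordered so that each `V(B k)` is consecutive,
which makes the orientation signs independent of the chosen facet.
-/

namespace BettiEdgeIdeal

open MvPolynomial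

universe u v w

/-! ### Homogeneous components of vectors of polynomials -/

section Components

variable {V : Type u} {K : Type v} [Field K] {n n' : ℕ}
  {δ : Fin n → V →₀ ℕ} {δ' : Fin n' → V →₀ ℕ}

open Classical in
/-- The projection of the graded free module `⨁ b, S(-δ b)` onto its part of degree `τ`. -/
noncomputable def component (δ : Fin n → V →₀ ℕ) (τ : V →₀ ℕ) :
    (Fin n → MvPolynomial V K) →ₗ[K] (Fin n → MvPolynomial V K) :=
  LinearMap.pi fun b =>
    if δ b ≤ τ then monomial (τ - δ b) ∘ₗ lcoeff K (τ - δ b) ∘ₗ LinearMap.proj b else 0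

open Classical in
lemma coeff_component (τ : V →₀ ℕ) (x : Fin n → MvPolynomial V K) (b : Fin n) (m : V →₀ ℕ) :
    coeff m (component δ τ x b) = if m + δ b = τ then coeff m (x b) else 0 := by
  unfold component
  simp only [LinearMap.pi_apply]
  by_cases h : δ b ≤ τ
  · simp only [h, if_true, LinearMap.comp_apply, LinearMap.proj_apply, lcoeff_apply,
      coeff_monomial]
    by_cases hm : m + δ b = τ
    · subst hm; simp
    · rw [if_neg hm, if_neg]
      rintro rfl
      exact hm (tsub_add_cancel_of_le h)
  · rw [if_neg h, if_neg]
    · simp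
    · rintro rfl
      exact h le_add_self

lemma component_isHomogeneous (τ : V →₀ ℕ) (x : Fin n → MvPolynomial V K) :
    IsHomogeneousOfDegree δ τ (component δ τ x) := by
  classical
  intro b m hm
  rw [coeff_component] at hm
  by_contra h
  simp [h] at hm

lemma component_eq_self {τ : V →₀ ℕ} {x : Fin n → MvPolynomial V K}
    (hx : IsHomogeneousOfDegree δ τ x) : component δ τ x = x := by
  classical
  ext b m
  rw [coeff_component]
  split_ifs with h
  · rfl
  · by_contra h'
    exact h (hx b m (Ne.symm h'))

lemma component_eq_zero {τ τ' : V →₀ ℕ} (hne : τ ≠ τ') {x : Fin n → MvPolynomial V K}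
    (hx : IsHomogeneousOfDegree δ τ' x) : component δ τ x = 0 := by
  classical
  ext b m
  rw [coeff_component]
  split_ifs with h
  · by_contra h'
    exact hne (h.symm.trans (hx b m h'))
  · simp

lemma isHomogeneousOfDegree_zero (τ : V →₀ ℕ) :
    IsHomogeneousOfDegree δ τ (0 : Fin n → MvPolynomial V K) := fun b m h => by simp at h

lemma IsHomogeneousOfDegree.add {τ : V →₀ ℕ} {x y : Fin n → MvPolynomial V K}
    (hx : IsHomogeneousOfDegree δ τ x) (hy : IsHomogeneousOfDegree δ τ y) :
    IsHomogeneousOfDegree δ τ (x + y) := by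
  intro b m h
  by_cases h1 : coeff m (x b) = 0
  · refine hy b m fun h2 => h ?_
    simp [h1, h2]
  · exact hx b m h1

lemma IsHomogeneousOfDegree.neg {τ : V →₀ ℕ} {x : Fin n → MvPolynomial V K}
    (hx : IsHomogeneousOfDegree δ τ x) : IsHomogeneousOfDegree δ τ (-x) := by
  intro b m h
  exact hx b m fun h' => h (by simp [h'])

lemma IsHomogeneousOfDegree.sub {τ : V →₀ ℕ} {x y : Fin n → MvPolynomial V K}
    (hx : IsHomogeneousOfDegree δ τ x) (hy : IsHomogeneousOfDegree δ τ y) :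
    IsHomogeneousOfDegree δ τ (x - y) := by
  rw [sub_eq_add_neg]; exact hx.add hy.neg

lemma IsHomogeneousOfDegree.zsmul {τ : V →₀ ℕ} {x : Fin n → MvPolynomial V K}
    (hx : IsHomogeneousOfDegree δ τ x) (c : ℤ) : IsHomogeneousOfDegree δ τ (c • x) := by
  intro b m h
  refine hx b m fun h' => h ?_
  rw [Pi.smul_apply, coeff_smul, h', smul_zero]

lemma IsHomogeneousOfDegree.sum {τ : V →₀ ℕ} {ι : Type*} {s : Finset ι}
    {f : ι → Fin n → MvPolynomial V K} (hf : ∀ j ∈ s, IsHomogeneousOfDegree δ τ (f j)) :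
    IsHomogeneousOfDegree δ τ (∑ j ∈ s, f j) :=
  Finset.sum_induction f (IsHomogeneousOfDegree δ τ) (fun _ _ => IsHomogeneousOfDegree.add)
    (isHomogeneousOfDegree_zero τ) hf

lemma IsHomogeneousOfDegree.smul {τ : V →₀ ℕ} {x : Fin n → MvPolynomial V K} {p : MvPolynomial V K}
    {ρ : V →₀ ℕ} (hx : IsHomogeneousOfDegree δ ρ x)
    (hp : ∀ m, coeff m p ≠ 0 → m + ρ = τ) :
    IsHomogeneousOfDegree δ τ (p • x) := by
  classical
  intro b m h
  rw [Pi.smul_apply, smul_eq_mul, coeff_mul] at h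
  obtain ⟨⟨m₁, m₂⟩, hm, hne⟩ := Finset.exists_ne_zero_of_sum_ne_zero h
  have h1 := hp m₁ (left_ne_zero_of_mul hne)
  have h2 := hx b m₂ (right_ne_zero_of_mul hne)
  rw [Finset.HasAntidiagonal.mem_antidiagonal] at hm
  rw [← hm, ← h1, ← h2, add_assoc]

lemma isHomogeneousOfDegree_single (b : Fin n) (m : V →₀ ℕ) (c : K) :
    IsHomogeneousOfDegree δ (m + δ b) (Pi.single b (monomial m c)) := by
  classical
  intro b' m' h
  rcases eq_or_ne b' b with rfl | hb
  · rw [Pi.single_eq_same, coeff_monomial] at h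
    have : m = m' := by by_contra h'; simp [h'] at h
    rw [this]
  · simp [Pi.single_eq_of_ne hb] at h

/-- Two linear maps on a free module agree if they agree on homogeneous elements. -/
lemma linearMap_ext_homogeneous {N : Type*} [AddCommGroup N] [Module K N]
    {f g : (Fin n → MvPolynomial V K) →ₗ[K] N} (δ : Fin n → V →₀ ℕ)
    (h : ∀ τ x, IsHomogeneousOfDegree δ τ x → f x = g x) : f = g := by
  classical
  refine LinearMap.pi_ext' fun b => MvPolynomial.linearMap_ext fun m => LinearMap.ext fun c => ?_
  exact h _ _ (isHomogeneousOfDegree_single b m c)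

lemma map_component (f : (Fin n' → MvPolynomial V K) →ₗ[K] (Fin n → MvPolynomial V K))
    (hf : ∀ τ x, IsHomogeneousOfDegree δ' τ x → IsHomogeneousOfDegree δ τ (f x))
    (τ : V →₀ ℕ) (x : Fin n' → MvPolynomial V K) :
    f (component δ' τ x) = component δ τ (f x) := by
  refine LinearMap.congr_fun (f := f ∘ₗ component δ' τ) (g := component δ τ ∘ₗ f)
    (linearMap_ext_homogeneous δ' fun τ' y hy => ?_) x
  rw [LinearMap.comp_apply, LinearMap.comp_apply]
  rcases eq_or_ne τ τ' with rfl | hne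
  · rw [component_eq_self hy, component_eq_self (hf _ _ hy)]
  · rw [component_eq_zero hne hy, component_eq_zero hne (hf _ _ hy), map_zero]

lemma exists_sum_component (δ : Fin n → V →₀ ℕ) (x : Fin n → MvPolynomial V K) :
    ∃ T : Finset (V →₀ ℕ), ∑ τ ∈ T, component δ τ x = x := by
  classical
  refine ⟨Finset.univ.biUnion fun b => (x b).support.image fun m => m + δ b, ?_⟩
  ext b m
  rw [Finset.sum_apply, coeff_sum]
  simp only [coeff_component]
  rw [Finset.sum_ite_eq]
  split_ifs with h
  · rfl
  · by_contra h'
    refine h (Finset.mem_biUnion.2 ⟨b, Finset.mem_univ _, Finset.mem_image.2 ⟨m, ?_, rfl⟩⟩)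
    exact mem_support_iff.2 (Ne.symm h')

/-- Elements of the graded maximal ideal are the polynomials without constant term. -/
lemma mem_span_range_X_iff (p : MvPolynomial V K) :
    p ∈ Ideal.span (Set.range (X : V → MvPolynomial V K)) ↔ coeff 0 p = 0 := by
  rw [← Set.image_univ, mem_ideal_span_X_image]
  constructor
  · intro h
    by_contra h0
    obtain ⟨i, -, hi⟩ := h 0 (mem_support_iff.2 h0)
    exact hi rfl
  · intro h m hm
    have hm0 : m ≠ 0 := by
      rintro rfl
      exact mem_support_iff.1 hm h
    obtain ⟨i, hi⟩ := Finsupp.ne_iff.1 hm0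
    exact ⟨i, Set.mem_univ _, hi⟩

end Components

/-! ### Existence of minimal resolutions -/

section Existence

variable {V : Type u} {K : Type v} [Field K] {n : ℕ} {δ : Fin n → V →₀ ℕ}

/-- `g` is a system of homogeneous generators of `N`, of degrees `ε`. -/
structure IsHomogeneousGenerators (δ : Fin n → V →₀ ℕ)
    (N : Submodule (MvPolynomial V K) (Fin n → MvPolynomial V K)) {k : ℕ}
    (ε : Fin k → V →₀ ℕ) (g : Fin k → Fin n → MvPolynomial V K) : Prop where
  homogeneous : ∀ j, IsHomogeneousOfDegree δ (ε j) (g j)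
  span_eq : Submodule.span (MvPolynomial V K) (Set.range g) = N

lemma exists_homogeneousGenerators [Finite V]
    (N : Submodule (MvPolynomial V K) (Fin n → MvPolynomial V K))
    (hN : ∀ x ∈ N, ∀ τ, component δ τ x ∈ N) :
    ∃ (k : ℕ) (ε : Fin k → V →₀ ℕ) (g : Fin k → Fin n → MvPolynomial V K),
      IsHomogeneousGenerators δ N ε g := by
  set T : Set (Fin n → MvPolynomial V K) := {x | x ∈ N ∧ ∃ τ, IsHomogeneousOfDegree δ τ x}
  have hT : Submodule.span (MvPolynomial V K) T = N := by
    refine le_antisymm (Submodule.span_le.2 fun x hx => hx.1) fun x hx => ?_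
    obtain ⟨s, hs⟩ := exists_sum_component δ x
    rw [← hs]
    exact Submodule.sum_mem _ fun τ _ =>
      Submodule.subset_span ⟨hN x hx τ, τ, component_isHomogeneous τ x⟩
  obtain ⟨s, hsT, hs⟩ := (Submodule.fg_span_iff_fg_span_finset_subset T).1
    (IsNoetherian.noetherian (Submodule.span (MvPolynomial V K) T))
  choose ε hε using fun j => (hsT (s.equivFin.symm j).2).2
  refine ⟨s.card, ε, fun j => s.equivFin.symm j, hε, ?_⟩
  rw [← hT, hs]
  congr 1
  ext x
  constructor
  · rintro ⟨j, rfl⟩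
    exact (s.equivFin.symm j).2
  · intro hx
    exact ⟨s.equivFin ⟨x, hx⟩, by simp⟩

lemma IsHomogeneousGenerators.map_homogeneous
    {N : Submodule (MvPolynomial V K) (Fin n → MvPolynomial V K)} {k : ℕ}
    {ε : Fin k → V →₀ ℕ} {g : Fin k → Fin n → MvPolynomial V K}
    (hg : IsHomogeneousGenerators δ N ε g) (τ : V →₀ ℕ) (x : Fin k → MvPolynomial V K)
    (hx : IsHomogeneousOfDegree ε τ x) :
    IsHomogeneousOfDegree δ τ (Fintype.linearCombination (MvPolynomial V K) g x) := by
  rw [Fintype.linearCombination_apply]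
  exact IsHomogeneousOfDegree.sum fun j _ => (hg.homogeneous j).smul (hx j)

/-- Graded Nakayama: the relations of a homogeneous generating system with the fewest members have
coefficients in `𝔪`, as a unit coefficient would make one of the generators superfluous. -/
lemma IsHomogeneousGenerators.relation_mem
    {N : Submodule (MvPolynomial V K) (Fin n → MvPolynomial V K)} {k : ℕ}
    {ε : Fin k → V →₀ ℕ} {g : Fin k → Fin n → MvPolynomial V K}
    (hg : IsHomogeneousGenerators δ N ε g)
    (hmin : ∀ (l : ℕ) (ε' : Fin l → V →₀ ℕ) (g' : Fin l → Fin n → MvPolynomial V K),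
      IsHomogeneousGenerators δ N ε' g' → k ≤ l)
    (x : Fin k → MvPolynomial V K) (hx : Fintype.linearCombination (MvPolynomial V K) g x = 0)
    (j : Fin k) : x j ∈ Ideal.span (Set.range (X : V → MvPolynomial V K)) := by
  classical
  rw [mem_span_range_X_iff]
  by_contra hc
  obtain _ | l := k
  · exact j.elim0
  -- The component of degree `ε j` of the relation has the constant `coeff 0 (x j)` as its
  -- coefficient at `g j`, so that `g j` lies in the span of the other generators.
  have hy : Fintype.linearCombination (MvPolynomial V K) g (component ε (ε j) x) = 0 := by
    have := map_component (δ' := ε) (δ := δ)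
      ((Fintype.linearCombination (MvPolynomial V K) g).restrictScalars K)
      (hg.map_homogeneous) (ε j) x
    rw [LinearMap.restrictScalars_apply, LinearMap.restrictScalars_apply, hx, map_zero] at this
    exact this
  have hyj : component ε (ε j) x j = C (coeff 0 (x j)) := by
    ext m
    rw [coeff_component, coeff_C]
    by_cases hm : m = 0
    · subst hm; simp
    · rw [if_neg (by simpa using hm), if_neg (Ne.symm hm)]
  set y := component ε (ε j) x
  rw [Fintype.linearCombination_apply, Fin.sum_univ_succAbove _ j, hyj] at hy
  set P := Submodule.span (MvPolynomial V K) (Set.range fun i => g (j.succAbove i))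
  have hP : ∀ i, g (j.succAbove i) ∈ P := fun i => Submodule.subset_span ⟨i, rfl⟩
  have hgj : g j ∈ P := by
    have h1 : (C (coeff 0 (x j)) : MvPolynomial V K) • g j ∈ P := by
      rw [eq_neg_of_add_eq_zero_left hy]
      exact P.neg_mem (P.sum_mem fun i _ => P.smul_mem _ (hP i))
    have h2 := P.smul_mem (C (coeff 0 (x j))⁻¹ : MvPolynomial V K) h1
    rwa [smul_smul, ← C_mul, inv_mul_cancel₀ hc, C_1, one_smul] at h2
  have := hmin l (fun i => ε (j.succAbove i)) (fun i => g (j.succAbove i))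
    ⟨fun i => hg.homogeneous _, by
      rw [← hg.span_eq]
      refine le_antisymm (Submodule.span_mono ?_) (Submodule.span_le.2 ?_)
      · rintro _ ⟨i, rfl⟩
        exact ⟨_, rfl⟩
      · rintro _ ⟨i, rfl⟩
        rcases Fin.eq_self_or_eq_succAbove j i with rfl | ⟨i, rfl⟩
        exacts [hgj, hP i]⟩
  omega

/-- A syzygy module: a homogeneous submodule, contained in `𝔪 F`, of a graded free module `F`. -/
structure Syzygy (V : Type u) (K : Type v) [Field K] where
  /-- the rank of the ambient free module -/
  rank : ℕ
  /-- the degrees of the basis of the ambient free module -/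
  degree : Fin rank → V →₀ ℕ
  /-- the submodule -/
  carrier : Submodule (MvPolynomial V K) (Fin rank → MvPolynomial V K)
  homogeneous : ∀ x ∈ carrier, ∀ τ, component degree τ x ∈ carrier
  minimal : ∀ x ∈ carrier, ∀ b, x b ∈ Ideal.span (Set.range (X : V → MvPolynomial V K))

/-- A minimal system of homogeneous generators covers a syzygy module by a free module, and the
kernel is the next syzygy module. -/
lemma Syzygy.exists_cover [Finite V] (N : Syzygy V K) :
    ∃ (N' : Syzygy V K) (f : (Fin N'.rank → MvPolynomial V K) →ₗ[MvPolynomial V K]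
        (Fin N.rank → MvPolynomial V K)),
      LinearMap.range f = N.carrier ∧ LinearMap.ker f = N'.carrier ∧
        ∀ τ x, IsHomogeneousOfDegree N'.degree τ x → IsHomogeneousOfDegree N.degree τ (f x) := by
  classical
  have hex := exists_homogeneousGenerators N.carrier N.homogeneous
  obtain ⟨ε, g, hg⟩ := Nat.find_spec hex
  have hmin : ∀ (l : ℕ) (ε' : Fin l → V →₀ ℕ) (g' : Fin l → Fin N.rank → MvPolynomial V K),
      IsHomogeneousGenerators N.degree N.carrier ε' g' → Nat.find hex ≤ l :=
    fun l ε' g' h => Nat.find_min' hex ⟨ε', g', h⟩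
  refine ⟨⟨Nat.find hex, ε, LinearMap.ker (Fintype.linearCombination (MvPolynomial V K) g), ?_,
    fun x hx => hg.relation_mem hmin x hx⟩, Fintype.linearCombination (MvPolynomial V K) g, ?_, rfl,
    hg.map_homogeneous⟩
  · intro x hx τ
    have := map_component (δ' := ε) (δ := N.degree)
      ((Fintype.linearCombination (MvPolynomial V K) g).restrictScalars K)
      (hg.map_homogeneous) τ x
    rw [LinearMap.restrictScalars_apply, LinearMap.restrictScalars_apply,
      LinearMap.mem_ker.1 hx, map_zero] at this
    exact this
  · rw [Fintype.range_linearCombination, hg.span_eq]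

/-- The quotient of `S` by a proper monomial ideal has a minimal resolution. -/
theorem nonempty_minimalFreeResolution [Finite V] (I : Ideal (MvPolynomial V K))
    (hI : ∀ p ∈ I, ∀ m, monomial m (coeff m p) ∈ I)
    (hI0 : I ≤ Ideal.span (Set.range (X : V → MvPolynomial V K))) :
    Nonempty (MinimalFreeResolution (quotientDegreePart I)) := by
  classical
  let aug : (Fin 1 → MvPolynomial V K) →ₗ[MvPolynomial V K] MvPolynomial V K ⧸ I :=
    I.mkQ ∘ₗ LinearMap.proj 0
  have haug : ∀ x, aug x = 0 ↔ x 0 ∈ I := fun x => Submodule.Quotient.mk_eq_zero I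
  let N₀ : Syzygy V K :=
    { rank := 1
      degree := 0
      carrier := LinearMap.ker aug
      homogeneous := fun x hx τ => by
        rw [LinearMap.mem_ker, haug] at hx ⊢
        convert hI _ hx τ using 1
        ext m
        rw [coeff_component, coeff_monomial]
        by_cases h : m = τ
        · subst h; simp
        · rw [if_neg (by simpa using h), if_neg (Ne.symm h)]
      minimal := fun x hx b => by
        rw [Subsingleton.elim b 0]
        exact hI0 ((haug x).1 hx) }
  choose next f hrange hker hhom using Syzygy.exists_cover (V := V) (K := K)
  let N : ℕ → Syzygy V K := fun i => Nat.rec N₀ (fun _ => next) i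
  refine ⟨⟨fun i => (N i).rank, fun i => (N i).degree, fun i => f (N i), aug,
    fun i => hhom (N i), ?_, ?_, ?_, ?_, ?_⟩⟩
  · intro τ x hx
    have hx0 : x 0 = monomial τ (coeff τ (x 0)) := by
      ext m
      rw [coeff_monomial]
      by_cases h : coeff m (x 0) = 0
      · split_ifs with h'
        · rw [h']
        · exact h
      · have : m + 0 = τ := hx 0 m h
        rw [add_zero] at this
        simp [this]
    refine ⟨monomial τ (coeff τ (x 0)), ⟨_, rfl⟩, ?_⟩
    rw [← hx0]
    rfl
  · intro y
    obtain ⟨p, rfl⟩ := Submodule.mkQ_surjective I y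
    exact ⟨fun _ => p, rfl⟩
  · rw [LinearMap.exact_iff]
    exact (hrange N₀).symm
  · intro i
    rw [LinearMap.exact_iff]
    exact (hker (N i)).trans (hrange (N (i + 1))).symm
  · intro i x b
    exact (N i).minimal _ ((hrange (N i)).le ⟨x, rfl⟩) b

end Existence

/-! ### The Koszul differential -/

section Koszul

variable {V : Type u} [LinearOrder V]

/-- The sign with which the vertex `v` is added to `W`: `-1` to the number of smaller elements. -/
def insertSign (W : Finset V) (v : V) : ℤ := (-1) ^ (W.filter (· < v)).card

lemma insertSign_mul_self (W : Finset V) (v : V) : insertSign W v * insertSign W v = 1 := by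
  rw [insertSign, ← mul_pow]; simp

lemma insertSign_insert {W : Finset V} {u v : V} (hu : u ∉ W) :
    insertSign (insert u W) v = if u < v then -insertSign W v else insertSign W v := by
  unfold insertSign
  rw [Finset.filter_insert]
  split_ifs with h
  · rw [Finset.card_insert_of_notMem (by simp [hu]), pow_succ]; ring
  · rfl

lemma insertSign_swap {W : Finset V} {u v : V} (hu : u ∉ W) (hv : v ∉ W) (huv : u ≠ v) :
    insertSign W u * insertSign (insert u W) v +
      insertSign W v * insertSign (insert v W) u = 0 := by
  rw [insertSign_insert hu, insertSign_insert hv]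
  rcases lt_or_gt_of_ne huv with h | h
  · rw [if_pos h, if_neg h.asymm]; ring
  · rw [if_neg h.asymm, if_pos h]; ring

variable {R : Type v} [CommRing R] {M : Type w} [AddCommGroup M] [Module R M]

/-- The Koszul differential of the family `x`. The value `f W` is the coefficient of the
exterior monomial complementary to `W`, so that the differential enlarges `W`. -/
def koszulD (x : V → R) (f : Finset V → M) (W : Finset V) : M :=
  ∑ v ∈ W, insertSign (W.erase v) v • x v • f (W.erase v)

lemma koszulD_congr (x : V → R) {f g : Finset V → M} {W : Finset V}
    (h : ∀ v ∈ W, f (W.erase v) = g (W.erase v)) : koszulD x f W = koszulD x g W :=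
  Finset.sum_congr rfl fun v hv => by rw [h v hv]

lemma koszulD_sub (x : V → R) (f g : Finset V → M) (W : Finset V) :
    koszulD x (fun U => f U - g U) W = koszulD x f W - koszulD x g W := by
  simp only [koszulD, smul_sub, Finset.sum_sub_distrib]

lemma map_koszulD {N : Type*} [AddCommGroup N] [Module R N] (L : M →ₗ[R] N) (x : V → R)
    (f : Finset V → M) (W : Finset V) :
    L (koszulD x f W) = koszulD x (fun U => L (f U)) W := by
  simp only [koszulD, map_sum, map_zsmul, map_smul]

lemma koszulD_koszulD (x : V → R) (f : Finset V → M) (W : Finset V) :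
    koszulD x (koszulD x f) W = 0 := by
  unfold koszulD
  simp only [Finset.smul_sum]
  rw [Finset.sum_sigma']
  refine Finset.sum_involution (fun p _ => ⟨p.2, p.1⟩) ?_ ?_ ?_ ?_
  · rintro ⟨v, u⟩ h
    simp only [Finset.mem_sigma, Finset.mem_erase] at h
    obtain ⟨hv, huv, hu⟩ := h
    have h1 : W.erase v = insert u ((W.erase v).erase u) :=
      (Finset.insert_erase (Finset.mem_erase.2 ⟨huv, hu⟩)).symm
    have h2 : W.erase u = insert v ((W.erase v).erase u) := by
      rw [Finset.erase_right_comm, Finset.insert_erase (Finset.mem_erase.2 ⟨huv.symm, hv⟩)]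
    have hs := insertSign_swap (W := (W.erase v).erase u) (u := u) (v := v) (by simp) (by simp) huv
    rw [← h1, ← h2] at hs
    dsimp only
    rw [Finset.erase_right_comm (a := u) (b := v)]
    set m := f ((W.erase v).erase u)
    have hc (a b : ℤ) (s t : R) : a • s • b • t • m = (b * a) • (t * s) • m := by
      rw [smul_comm s b, smul_smul a, mul_comm a, smul_smul s, mul_comm s]
    rw [hc, hc, mul_comm (x v), ← add_smul, hs, zero_smul]
  · rintro ⟨v, u⟩ h _ he
    simp only [Finset.mem_sigma, Finset.mem_erase] at h
    simp only [Sigma.mk.injEq] at he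
    exact h.2.1 he.1
  · rintro ⟨v, u⟩ h
    simp only [Finset.mem_sigma, Finset.mem_erase] at h ⊢
    exact ⟨h.2.2, h.2.1.symm, h.1⟩
  · rintro ⟨v, u⟩ h
    rfl

/-- The contraction of the Koszul complex of a unit, written in the direction of the vertex `v`. -/
def coneHomotopy (v : V) (f : Finset V → M) (W : Finset V) : M :=
  if v ∈ W then 0 else insertSign W v • f (insert v W)

lemma koszulD_coneHomotopy (x : V → R) (v : V) (hx : x v = 1) (f : Finset V → M) (W : Finset V) :
    koszulD x (coneHomotopy v f) W + coneHomotopy v (koszulD x f) W = f W := by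
  by_cases hv : v ∈ W
  · rw [coneHomotopy, if_pos hv, add_zero, koszulD, Finset.sum_eq_single v]
    · rw [coneHomotopy, if_neg (by simp), Finset.insert_erase hv, hx, one_smul, smul_smul,
        insertSign_mul_self, one_smul]
    · intro u hu huv
      rw [coneHomotopy, if_pos (by simp [hv, huv.symm]), smul_zero, smul_zero]
    · exact fun h => absurd hv h
  · rw [coneHomotopy, if_neg hv]
    unfold koszulD
    rw [Finset.sum_insert hv, Finset.erase_insert hv, hx, one_smul, smul_add, smul_smul,
      insertSign_mul_self, one_smul, add_comm (f W), ← add_assoc, Finset.smul_sum,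
      ← Finset.sum_add_distrib]
    rw [Finset.sum_eq_zero, zero_add]
    intro u hu
    have huv : u ≠ v := by rintro rfl; exact hv hu
    have hA : v ∉ W.erase u := by simp [hv]
    have h1 : (insert v W).erase u = insert v (W.erase u) :=
      Finset.erase_insert_of_ne huv.symm
    have hs := insertSign_swap (W := W.erase u) (u := u) (v := v) (by simp) hA huv
    rw [Finset.insert_erase hu] at hs
    rw [coneHomotopy, if_neg hA, h1, smul_comm (x u), smul_smul, smul_smul, ← add_smul]
    have h2 := insertSign_mul_self (W.erase u) v
    have h3 := insertSign_mul_self W v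
    rw [show insertSign (W.erase u) u * insertSign (W.erase u) v +
      insertSign W v * insertSign (insert v (W.erase u)) u = 0 by
        linear_combination (insertSign (W.erase u) v * insertSign W v) * hs -
          (insertSign (W.erase u) u * insertSign (W.erase u) v) * h3 -
          (insertSign W v * insertSign (insert v (W.erase u)) u) * h2, zero_smul]

end Koszul

/-! ### Exactness of the Koszul complex of a graded free module -/

section FreeExactness

lemma zeroOneVector_apply {V : Type u} [DecidableEq V] (W : Finset V) (v : V) :
    zeroOneVector W v = if v ∈ W then 1 else 0 := by
  rw [zeroOneVector, Finsupp.finsetSum_apply]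
  simp [Finsupp.single_apply]

variable {V : Type u} [LinearOrder V] {K : Type v} [Field K] {n : ℕ} {δ : Fin n → V →₀ ℕ}

lemma zeroOneVector_erase {W : Finset V} {v : V} (hv : v ∈ W) :
    Finsupp.single v 1 + zeroOneVector (W.erase v) = zeroOneVector W :=
  Finset.add_sum_erase _ (fun a => Finsupp.single a 1) hv

lemma koszulD_isHomogeneous {x : Finset V → Fin n → MvPolynomial V K} {W : Finset V}
    (hx : ∀ v ∈ W, IsHomogeneousOfDegree δ (zeroOneVector (W.erase v)) (x (W.erase v))) :
    IsHomogeneousOfDegree δ (zeroOneVector W) (koszulD (X : V → MvPolynomial V K) x W) := by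
  classical
  refine IsHomogeneousOfDegree.sum fun v hv => ((hx v hv).smul fun m hm => ?_).zsmul _
  rw [← zeroOneVector_erase hv]
  rw [coeff_X] at hm
  have : Finsupp.single v 1 = m := by by_contra h; simp [h] at hm
  rw [this]

/-- Setting all variables to `1` loses no information on homogeneous elements of a fixed degree. -/
lemma IsHomogeneousOfDegree.eq_of_eval {τ : V →₀ ℕ} {x y : Fin n → MvPolynomial V K}
    (hx : IsHomogeneousOfDegree δ τ x) (hy : IsHomogeneousOfDegree δ τ y) {b : Fin n}
    (h : eval (fun _ => (1 : K)) (x b) = eval (fun _ => (1 : K)) (y b)) : x b = y b := by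
  classical
  have key : ∀ z : Fin n → MvPolynomial V K, IsHomogeneousOfDegree δ τ z →
      z b = monomial (τ - δ b) (coeff (τ - δ b) (z b)) := by
    intro z hz
    ext m
    rw [coeff_monomial]
    by_cases hm : coeff m (z b) = 0
    · split_ifs with h'
      · rw [h']
      · exact hm
    · rw [← hz b m hm]; simp
  rw [key x hx, key y hy] at h ⊢
  simp only [eval_monomial, one_pow, Finsupp.prod_fun_one, mul_one] at h
  rw [h]

lemma eval_koszulD (x : Finset V → Fin n → MvPolynomial V K) (W : Finset V) (b : Fin n) :
    eval (fun _ => (1 : K)) (koszulD (X : V → MvPolynomial V K) x W b) =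
      koszulD (fun _ => (1 : K)) (fun U => eval (fun _ => (1 : K)) (x U b)) W := by
  simp [koszulD, Finset.sum_apply]

lemma exists_koszulD_eq_of_apply_eq_zero {σ : Finset V} {q : ℕ} {b : Fin n} {v : V} (hvσ : v ∈ σ)
    (hv : δ b v = 0) (x : Finset V → Fin n → MvPolynomial V K)
    (hx : ∀ W ⊆ σ, W.card = q → IsHomogeneousOfDegree δ (zeroOneVector W) (x W))
    (hd : ∀ W ⊆ σ, W.card = q + 1 → koszulD (X : V → MvPolynomial V K) x W b = 0) :
    ∃ g : Finset V → Fin n → MvPolynomial V K,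
      (∀ W ⊆ σ, W.card + 1 = q → IsHomogeneousOfDegree δ (zeroOneVector W) (g W)) ∧
      ∀ W ⊆ σ, W.card = q → x W b = koszulD (X : V → MvPolynomial V K) g W b := by
  classical
  -- Contract the scalar cochain obtained by setting all variables to `1`, and reinsert monomials;
  -- `component` discards the values at sets `W` for which `S(-δ b)` vanishes in degree `W`.
  set c : Finset V → K := fun W => eval (fun _ => (1 : K)) (x W b)
  set c' := coneHomotopy v c
  refine ⟨fun W => component δ (zeroOneVector W)
      (Pi.single b (monomial (zeroOneVector W - δ b) (c' W))),
    fun W _ _ => component_isHomogeneous _ _, fun W hW hq => ?_⟩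
  have hcard : ∀ u ∈ W, (W.erase u).card + 1 = q := fun u hu => by
    rw [Finset.card_erase_add_one hu, hq]
  refine (hx W hW hq).eq_of_eval
    (koszulD_isHomogeneous fun u hu => component_isHomogeneous _ _) ?_
  rw [eval_koszulD]
  have hc : c W = koszulD (fun _ => (1 : K)) c' W := by
    conv_lhs => rw [← koszulD_coneHomotopy (fun _ => (1 : K)) v rfl c W]
    rw [coneHomotopy]
    split_ifs with hvW
    · rw [add_zero]
    · rw [← eval_koszulD, hd _ (Finset.insert_subset hvσ hW)
        (by rw [Finset.card_insert_of_notMem hvW, hq]), map_zero, smul_zero, add_zero]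
  rw [show eval (fun _ => (1 : K)) (x W b) = c W from rfl, hc]
  refine koszulD_congr _ fun u hu => ?_
  set U := W.erase u
  have hUσ : U ⊆ σ := (Finset.erase_subset u W).trans hW
  by_cases hle : δ b ≤ zeroOneVector U
  · have hhom := isHomogeneousOfDegree_single (δ := δ) b (zeroOneVector U - δ b) (c' U)
    rw [tsub_add_cancel_of_le hle] at hhom
    rw [component_eq_self hhom, Pi.single_eq_same, eval_monomial]
    simp
  · have h0 : component δ (zeroOneVector U)
        (Pi.single b (monomial (zeroOneVector U - δ b) (c' U))) b = 0 := by
      ext m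
      rw [coeff_component, if_neg, coeff_zero]
      exact fun h => hle (h ▸ le_add_self)
    rw [h0, map_zero]
    change coneHomotopy v c U = 0
    rw [coneHomotopy]
    split_ifs with hvU
    · rfl
    · have : x (insert v U) b = 0 := by
        by_contra hne
        obtain ⟨m, hm⟩ := MvPolynomial.ne_zero_iff.1 hne
        have h1 := hx (insert v U) (Finset.insert_subset hvσ hUσ)
          (by rw [Finset.card_insert_of_notMem hvU, hcard u hu]) b m hm
        refine hle fun a => ?_
        have h2 := DFunLike.congr_fun h1 a
        rw [Finsupp.add_apply, zeroOneVector_apply] at h2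
        rw [zeroOneVector_apply]
        rcases eq_or_ne a v with rfl | hav
        · rw [hv]; exact Nat.zero_le _
        · simp only [Finset.mem_insert, hav, false_or] at h2
          omega
      simp [c, this]

/-- The Koszul complex of `⨁ b, S(-δ b)` is exact in degree `σ`, except for the homology that each
summand `S(-σ)` contributes at the full vertex set. -/
lemma exists_koszulD_eq {σ : Finset V} {q : ℕ}
    (hq : q < σ.card ∨ ∀ b, δ b ≠ zeroOneVector σ) (x : Finset V → Fin n → MvPolynomial V K)
    (hx : ∀ W ⊆ σ, W.card = q → IsHomogeneousOfDegree δ (zeroOneVector W) (x W))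
    (hd : ∀ W ⊆ σ, W.card = q + 1 → koszulD (X : V → MvPolynomial V K) x W = 0) :
    ∃ g : Finset V → Fin n → MvPolynomial V K,
      (∀ W ⊆ σ, W.card + 1 = q → IsHomogeneousOfDegree δ (zeroOneVector W) (g W)) ∧
      ∀ W ⊆ σ, W.card = q → x W = koszulD (X : V → MvPolynomial V K) g W := by
  classical
  have hcoord : ∀ b, ∃ g : Finset V → Fin n → MvPolynomial V K,
      (∀ W ⊆ σ, W.card + 1 = q → IsHomogeneousOfDegree δ (zeroOneVector W) (g W)) ∧
      ∀ W ⊆ σ, W.card = q → x W b = koszulD (X : V → MvPolynomial V K) g W b := by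
    intro b
    by_cases h : ∃ v ∈ σ, δ b v = 0
    · obtain ⟨v, hvσ, hv⟩ := h
      exact exists_koszulD_eq_of_apply_eq_zero hvσ hv x hx fun W hW hWq => by
        rw [hd W hW hWq]; rfl
    · -- Here `S(-δ b)` has no elements in any of the degrees `W ⊆ σ` with `W.card = q`.
      push Not at h
      refine ⟨0, fun W _ _ => isHomogeneousOfDegree_zero _, fun W hW hWq => ?_⟩
      have h0 : koszulD (X : V → MvPolynomial V K)
          (0 : Finset V → Fin n → MvPolynomial V K) W b = 0 := by
        simp [koszulD]
      rw [h0]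
      by_contra hne
      obtain ⟨m, hm⟩ := MvPolynomial.ne_zero_iff.1 hne
      have h1 := fun a => DFunLike.congr_fun (hx W hW hWq b m hm) a
      simp only [Finsupp.add_apply, zeroOneVector_apply] at h1
      have hWσ : W = σ := by
        refine hW.antisymm fun a ha => ?_
        by_contra haW
        have := h1 a
        have := h a ha
        simp [haW] at *
        omega
      subst hWσ
      refine hq.elim (fun hlt => by omega) fun hb => hb b ?_
      ext a
      have := h1 a
      rw [zeroOneVector_apply]
      split_ifs at this ⊢ with ha
      · have := h a ha
        omega
      · omega
  choose g hg hxg using hcoord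
  refine ⟨fun W b => g b W b, fun W hW hWq b m hm => hg b W hW hWq b m hm, fun W hW hWq => ?_⟩
  ext1 b
  rw [hxg b W hW hWq]
  simp [koszulD, Finset.sum_apply]

end FreeExactness

/-! ### The zigzag between a resolution and the Koszul complex -/

section Zigzag

variable {V : Type u} {K : Type v} [Field K]
  {M : Type w} [AddCommGroup M] [Module K M] [Module (MvPolynomial V K) M]
  [IsScalarTower K (MvPolynomial V K) M] {𝓜 : (V →₀ ℕ) → Submodule K M}

lemma MinimalFreeResolution.d_component (F : MinimalFreeResolution 𝓜) (i : ℕ) (τ : V →₀ ℕ)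
    (x : Fin (F.rank (i + 1)) → MvPolynomial V K) :
    F.d i (component (F.degree (i + 1)) τ x) = component (F.degree i) τ (F.d i x) :=
  map_component ((F.d i).restrictScalars K) (F.d_homogeneous i) τ x

lemma MinimalFreeResolution.exists_homogeneous_d_eq (F : MinimalFreeResolution 𝓜) {i : ℕ}
    {τ : V →₀ ℕ} {y : Fin (F.rank i) → MvPolynomial V K}
    (hy : IsHomogeneousOfDegree (F.degree i) τ y) (hyd : ∃ x, F.d i x = y) :
    ∃ x, IsHomogeneousOfDegree (F.degree (i + 1)) τ x ∧ F.d i x = y := by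
  obtain ⟨x, rfl⟩ := hyd
  exact ⟨component _ τ x, component_isHomogeneous _ _, by rw [F.d_component, component_eq_self hy]⟩

variable [LinearOrder V]

/-- Diagram chase in the double complex `F ⊗ Koszul` in degree `σ`. If `F` has no generator of
degree `σ` in homological degree `p + j`, then a cochain with values in `F p`, on the sets of
cardinality `q = |σ| - j`, whose Koszul differential comes from `F (p + 1)`, is up to an element
coming from `F (p + 1)` itself a Koszul boundary. -/
lemma MinimalFreeResolution.zigzag (F : MinimalFreeResolution 𝓜) {σ : Finset V} (j : ℕ) :
    ∀ (p q : ℕ), q + j = σ.card → (∀ b, F.degree (p + j) b ≠ zeroOneVector σ) →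
    ∀ (x : Finset V → Fin (F.rank p) → MvPolynomial V K)
      (y : Finset V → Fin (F.rank (p + 1)) → MvPolynomial V K),
    (∀ W ⊆ σ, W.card = q → IsHomogeneousOfDegree (F.degree p) (zeroOneVector W) (x W)) →
    (∀ W ⊆ σ, W.card = q + 1 →
      IsHomogeneousOfDegree (F.degree (p + 1)) (zeroOneVector W) (y W)) →
    (∀ W ⊆ σ, W.card = q + 1 → koszulD (X : V → MvPolynomial V K) x W = F.d p (y W)) →
    ∃ (g : Finset V → Fin (F.rank p) → MvPolynomial V K)
      (h : Finset V → Fin (F.rank (p + 1)) → MvPolynomial V K),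
    (∀ W ⊆ σ, W.card + 1 = q → IsHomogeneousOfDegree (F.degree p) (zeroOneVector W) (g W)) ∧
    (∀ W ⊆ σ, W.card = q → IsHomogeneousOfDegree (F.degree (p + 1)) (zeroOneVector W) (h W)) ∧
    ∀ W ⊆ σ, W.card = q → x W = koszulD (X : V → MvPolynomial V K) g W + F.d p (h W) := by
  induction j with
  | zero =>
    intro p q hq hno x y hx hy hxy
    obtain ⟨g, hg, hxg⟩ := exists_koszulD_eq (δ := F.degree p) (q := q) (Or.inr hno) x hx
      fun W hW hWq => by
        have := Finset.card_le_card hW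
        omega
    refine ⟨g, fun _ => 0, hg, fun _ _ _ => isHomogeneousOfDegree_zero _, fun W hW hWq => ?_⟩
    rw [hxg W hW hWq, map_zero, add_zero]
  | succ j ih =>
    intro p q hq hno x y hx hy hxy
    have hlift : ∀ W, W ⊆ σ → W.card = q + 1 + 1 →
        ∃ z, IsHomogeneousOfDegree (F.degree (p + 1 + 1)) (zeroOneVector W) z ∧
          F.d (p + 1) z = koszulD (X : V → MvPolynomial V K) y W := by
      intro W hW hWq
      have hcard : ∀ v ∈ W, (W.erase v).card = q + 1 := fun v hv => by
        have := Finset.card_erase_add_one hv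
        omega
      have hsub : ∀ v, W.erase v ⊆ σ := fun v => (Finset.erase_subset v W).trans hW
      refine F.exists_homogeneous_d_eq
        (koszulD_isHomogeneous fun v hv => hy _ (hsub v) (hcard v hv)) ?_
      rw [← Set.mem_range, ← F.exact_d p, map_koszulD,
        ← koszulD_congr (X : V → MvPolynomial V K) fun v hv => hxy _ (hsub v) (hcard v hv)]
      exact koszulD_koszulD (X : V → MvPolynomial V K) x W
    choose! z hz hzy using hlift
    -- By induction `y` is a boundary up to elements of the image of `F (p + 2)`, which the
    -- differential of `F` kills; subtracting the image of `g'` turns `x` into a Koszul cycle.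
    obtain ⟨g', h', hg', hh', hy'⟩ := ih (p + 1) (q + 1) (by omega)
      (by rwa [show p + 1 + j = p + (j + 1) by omega]) y z hy hz fun W hW hWq => (hzy W hW hWq).symm
    obtain ⟨g, hg, hxg⟩ := exists_koszulD_eq (δ := F.degree p) (σ := σ) (q := q)
      (Or.inl (by omega)) (fun W => x W - F.d p (g' W))
      (fun W hW hWq => (hx W hW hWq).sub (F.d_homogeneous p _ _ (hg' W hW (by omega))))
      (fun W hW hWq => by
        rw [koszulD_sub, hxy W hW hWq, hy' W hW hWq, map_add, map_koszulD,
          (F.exact_d p _).2 ⟨_, rfl⟩, add_zero, sub_self])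
    refine ⟨g, g', hg, fun W hW hWq => hg' W hW (by omega), fun W hW hWq => ?_⟩
    rw [← hxg W hW hWq, sub_add_cancel]

end Zigzag

/-! ### The edge ideal -/

section EdgeIdeal

variable {V : Type u} {K : Type v} [Field K] {G : SimpleGraph V}

lemma mem_edgeIdeal_iff (p : MvPolynomial V K) :
    p ∈ edgeIdeal K G ↔ ∀ m, coeff m p ≠ 0 →
      ∃ a b, G.Adj a b ∧ Finsupp.single a 1 + Finsupp.single b 1 ≤ m := by
  have : {f : MvPolynomial V K | ∃ a b : V, G.Adj a b ∧ f = X a * X b} =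
      (fun s => monomial s 1) ''
        {s | ∃ a b, G.Adj a b ∧ s = Finsupp.single a 1 + Finsupp.single b 1} := by
    ext f
    constructor
    · rintro ⟨a, b, hab, rfl⟩
      exact ⟨_, ⟨a, b, hab, rfl⟩, by simp [X, monomial_mul]⟩
    · rintro ⟨_, ⟨a, b, hab, rfl⟩, rfl⟩
      exact ⟨a, b, hab, by simp [X, monomial_mul]⟩
  rw [edgeIdeal, this, mem_ideal_span_monomial_image]
  constructor
  · intro h m hm
    obtain ⟨_, ⟨a, b, hab, rfl⟩, hle⟩ := h m (mem_support_iff.2 hm)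
    exact ⟨a, b, hab, hle⟩
  · intro h m hm
    obtain ⟨a, b, hab, hle⟩ := h m (mem_support_iff.1 hm)
    exact ⟨_, ⟨a, b, hab, rfl⟩, hle⟩

lemma monomial_coeff_mem_edgeIdeal {p : MvPolynomial V K} (hp : p ∈ edgeIdeal K G) (m : V →₀ ℕ) :
    monomial m (coeff m p) ∈ edgeIdeal K G := by
  classical
  rw [mem_edgeIdeal_iff] at hp ⊢
  intro m' hm'
  rw [coeff_monomial] at hm'
  split_ifs at hm' with h
  · exact h ▸ hp m hm'
  · exact absurd rfl hm'

lemma edgeIdeal_le_span_range_X :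
    edgeIdeal K G ≤ Ideal.span (Set.range (X : V → MvPolynomial V K)) := by
  refine Ideal.span_le.2 ?_
  rintro _ ⟨a, b, -, rfl⟩
  exact Ideal.mul_mem_right _ _ (Ideal.subset_span ⟨a, rfl⟩)

lemma monomial_mem_edgeIdeal {W : Finset V} {a b : V} (ha : a ∈ W) (hb : b ∈ W) (hab : G.Adj a b)
    (c : K) : monomial (zeroOneVector W) c ∈ edgeIdeal K G := by
  classical
  rw [mem_edgeIdeal_iff]
  intro m hm
  rw [coeff_monomial] at hm
  have hm' : zeroOneVector W = m := by by_contra h; simp [h] at hm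
  subst hm'
  refine ⟨a, b, hab, ?_⟩
  have hsub : ({a, b} : Finset V) ⊆ W := by
    intro x hx
    simp only [Finset.mem_insert, Finset.mem_singleton] at hx
    rcases hx with rfl | rfl <;> assumption
  rw [← Finset.sum_pair (f := fun x => (Finsupp.single x 1 : V →₀ ℕ)) hab.ne]
  exact Finset.sum_le_sum_of_subset hsub

lemma coeff_eq_zero_of_mem_edgeIdeal {p : MvPolynomial V K} (hp : p ∈ edgeIdeal K G) {W : Finset V}
    (hW : ∀ a ∈ W, ∀ b ∈ W, ¬ G.Adj a b) : coeff (zeroOneVector W) p = 0 := by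
  classical
  by_contra h
  obtain ⟨a, b, hab, hle⟩ := (mem_edgeIdeal_iff p).1 hp _ h
  refine hW a ?_ b ?_ hab
  · by_contra ha
    have := hle a
    simp [zeroOneVector_apply, ha] at this
  · by_contra hb
    have := hle b
    simp [zeroOneVector_apply, hb] at this

/-- A resolution lifts a residue class of a monomial to a homogeneous element of the same degree. -/
lemma MinimalFreeResolution.exists_homogeneous_aug_eq
    (F : MinimalFreeResolution (quotientDegreePart (edgeIdeal K G))) (m : V →₀ ℕ) (c : K) :
    ∃ x, IsHomogeneousOfDegree (F.degree 0) m x ∧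
      F.aug x = Ideal.Quotient.mk (edgeIdeal K G) (monomial m c) := by
  classical
  obtain ⟨y, hy⟩ := F.aug_surjective (Ideal.Quotient.mk (edgeIdeal K G) (monomial m c))
  refine ⟨component _ m y, component_isHomogeneous _ _, ?_⟩
  have hcomp : ∀ τ, ∃ k : K, Ideal.Quotient.mk (edgeIdeal K G) (monomial τ k) =
      F.aug (component (F.degree 0) τ y) := fun τ => by
    obtain ⟨_, ⟨k, rfl⟩, hk⟩ := F.aug_homogeneous τ _ (component_isHomogeneous τ y)
    exact ⟨k, hk⟩
  choose k hk using hcomp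
  obtain ⟨T, hT⟩ := exists_sum_component (F.degree 0) y
  have hdiff : monomial m c - ∑ τ ∈ T, monomial τ (k τ) ∈ edgeIdeal K G := by
    rw [← Ideal.Quotient.eq, ← hy, map_sum]
    simp only [hk]
    rw [← map_sum, hT]
  have hm := monomial_coeff_mem_edgeIdeal hdiff m
  rw [coeff_sub, coeff_monomial, if_pos rfl, coeff_sum] at hm
  simp only [coeff_monomial] at hm
  rw [Finset.sum_ite_eq', map_sub, ← Ideal.Quotient.eq] at hm
  rw [hm]
  split_ifs with hmT
  · exact (hk m).symm
  · have : component (F.degree 0) m y = 0 := by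
      conv_lhs => rw [← hT]
      rw [map_sum]
      refine Finset.sum_eq_zero fun τ hτ => component_eq_zero ?_ (component_isHomogeneous τ y)
      rintro rfl
      exact hmT hτ
    rw [this]
    simp

lemma koszulD_monomial [LinearOrder V] (κ : Finset V → K) (W : Finset V) :
    koszulD (X : V → MvPolynomial V K) (fun U => monomial (zeroOneVector U) (κ U)) W =
      monomial (zeroOneVector W) (koszulD (fun _ => (1 : K)) κ W) := by
  rw [koszulD, koszulD, map_sum]
  refine Finset.sum_congr rfl fun v hv => ?_
  rw [map_zsmul, one_smul, smul_eq_mul, X, monomial_mul, one_mul, zeroOneVector_erase hv]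

/-- The part of Hochster's formula needed here: if some cochain `ζ` on the sets of cardinality `q`
is a cocycle on the independence complex of `G` restricted to `σ` but not a coboundary there, then
every resolution has a summand `S(-σ)` in homological degree `|σ| - q`. -/
lemma MinimalFreeResolution.exists_degree_eq [LinearOrder V]
    (F : MinimalFreeResolution (quotientDegreePart (edgeIdeal K G))) {σ : Finset V} {q : ℕ}
    (hq : q ≤ σ.card) (ζ : Finset V → K)
    (hζ : ∀ W ⊆ σ, W.card = q + 1 → (∀ a ∈ W, ∀ b ∈ W, ¬ G.Adj a b) →
      koszulD (fun _ => (1 : K)) ζ W = 0)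
    (hζ' : ∀ κ : Finset V → K, ∃ W ⊆ σ, W.card = q ∧ (∀ a ∈ W, ∀ b ∈ W, ¬ G.Adj a b) ∧
      ζ W ≠ koszulD (fun _ => (1 : K)) κ W) :
    ∃ b, F.degree (σ.card - q) b = zeroOneVector σ := by
  by_contra! hno
  let π := (edgeIdeal K G).mkQ
  have hπ : ∀ p, π p = Ideal.Quotient.mk (edgeIdeal K G) p := fun _ => rfl
  choose x hx hxaug using fun W : Finset V =>
    F.exists_homogeneous_aug_eq (zeroOneVector W) (ζ W)
  have hcocycle : ∀ W, W ⊆ σ → W.card = q + 1 →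
      ∃ y, IsHomogeneousOfDegree (F.degree 1) (zeroOneVector W) y ∧
        F.d 0 y = koszulD (X : V → MvPolynomial V K) x W := by
    intro W hW hWq
    refine F.exists_homogeneous_d_eq (koszulD_isHomogeneous fun v _ => hx _) ?_
    rw [← Set.mem_range, ← F.exact_aug, map_koszulD]
    simp only [hxaug, ← hπ]
    rw [← map_koszulD, koszulD_monomial, hπ, Ideal.Quotient.eq_zero_iff_mem]
    by_cases hind : ∀ a ∈ W, ∀ b ∈ W, ¬ G.Adj a b
    · rw [hζ W hW hWq hind, map_zero]
      exact Ideal.zero_mem _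
    · push Not at hind
      obtain ⟨a, ha, b, hb, hab⟩ := hind
      exact monomial_mem_edgeIdeal ha hb hab _
  choose! y hy hyx using hcocycle
  obtain ⟨g, h, hg, -, hxg⟩ := F.zigzag (σ.card - q) 0 q (by omega) (by rwa [zero_add]) x y
    (fun W _ _ => hx W) hy fun W hW hWq => (hyx W hW hWq).symm
  have hκ : ∀ W, W ⊆ σ → W.card + 1 = q → ∃ k : K,
      π (monomial (zeroOneVector W) k) = F.aug (g W) := fun W hW hWq => by
    obtain ⟨_, ⟨k, rfl⟩, hk⟩ := F.aug_homogeneous _ _ (hg W hW hWq)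
    exact ⟨k, hk⟩
  choose! κ hκ using hκ
  obtain ⟨W, hW, hWq, hind, hne⟩ := hζ' κ
  refine hne ?_
  have h1 : π (monomial (zeroOneVector W) (ζ W)) =
      π (monomial (zeroOneVector W) (koszulD (fun _ => (1 : K)) κ W)) := by
    rw [hπ, ← hxaug, hxg W hW hWq, map_add, (F.exact_aug _).2 ⟨_, rfl⟩, add_zero,
      ← koszulD_monomial, map_koszulD, map_koszulD]
    refine koszulD_congr _ fun v hv => (hκ _ ((Finset.erase_subset v W).trans hW) ?_).symm
    rw [Finset.card_erase_add_one hv, hWq]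
  rw [hπ, hπ, Ideal.Quotient.eq, ← map_sub] at h1
  have h2 := coeff_eq_zero_of_mem_edgeIdeal h1 hind
  rw [coeff_monomial, if_pos rfl] at h2
  exact sub_eq_zero.1 h2

end EdgeIdeal

/-! ### The cross-polytope in the independence complex -/

section CrossPolytope

variable {V : Type u} [LinearOrder V] {K : Type v} [Field K] {r : ℕ}

open Classical in
/-- The indicator function of the sets contained in `P` with at most one point in each fibre of
`part`. With `P` the union of the first parts of the bipartite graphs, it is the pullback of a
top-dimensional cochain under the retraction onto the cross-polytope. -/
noncomputable def transversalCochain (K : Type v) [Field K] (part : V → Fin r) (P : Set V)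
    (W : Finset V) : K :=
  if (W : Set V) ⊆ P ∧ Set.InjOn part W then 1 else 0

lemma koszulD_transversalCochain_of_lt {part : V → Fin r} (hmono : Monotone part) {P : Set V}
    {W : Finset V} (hWP : (W : Set V) ⊆ P) {u v : V} (hu : u ∈ W) (hv : v ∈ W) (huv : u < v)
    (hpart : part u = part v)
    (H : ∀ x ∈ W, ∀ y ∈ W, part x = part y → x = y ∨ (x = u ∧ y = v) ∨ (x = v ∧ y = u)) :
    koszulD (fun _ => (1 : K)) (transversalCochain K part P) W = 0 := by
  classical
  have hsub (x : V) : ((W.erase x : Finset V) : Set V) ⊆ P :=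
    fun y hy => hWP (Finset.mem_of_mem_erase hy)
  have hone : ∀ x, (x = u ∨ x = v) → transversalCochain K part P (W.erase x) = 1 := by
    intro x hx
    refine if_pos ⟨hsub x, fun y hy z hz hyz => ?_⟩
    simp only [Finset.coe_erase, Set.mem_sdiff, Finset.mem_coe, Set.mem_singleton_iff] at hy hz
    have := H y hy.1 z hz.1 hyz
    grind
  have hsign : insertSign (W.erase u) u + insertSign (W.erase v) v = 0 := by
    have : (W.erase v).filter (· < v) = insert u ((W.erase u).filter (· < u)) := by
      ext x
      simp only [Finset.mem_filter, Finset.mem_erase, Finset.mem_insert]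
      constructor
      · rintro ⟨⟨hxv, hxW⟩, hlt⟩
        rcases lt_trichotomy x u with h | h | h
        · exact Or.inr ⟨⟨h.ne, hxW⟩, h⟩
        · exact Or.inl h
        · have : part x = part u :=
            le_antisymm ((hmono hlt.le).trans hpart.ge) (hmono h.le)
          have := H x hxW u hu this
          have := huv.ne
          grind
      · rintro (rfl | ⟨⟨_, hxW⟩, hlt⟩)
        · exact ⟨⟨huv.ne, hu⟩, huv⟩
        · exact ⟨⟨(hlt.trans huv).ne, hxW⟩, hlt.trans huv⟩
    rw [insertSign, insertSign, this, Finset.card_insert_of_notMem (by simp), pow_succ]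
    ring
  rw [koszulD, Finset.sum_eq_add u v huv.ne]
  · rw [hone u (Or.inl rfl), hone v (Or.inr rfl), ← add_smul, hsign, zero_smul]
  · rintro x hx ⟨hxu, hxv⟩
    rw [transversalCochain, if_neg, smul_zero, smul_zero]
    rintro ⟨-, hinj⟩
    exact huv.ne (hinj (by simp [hu, hxu.symm]) (by simp [hv, hxv.symm]) hpart)
  · exact fun h => absurd hu h
  · exact fun h => absurd hv h

/-- The transversal cochain is a cocycle on the independence complex. -/
lemma koszulD_transversalCochain {part : V → Fin r} (hmono : Monotone part) {P : Set V}
    {G : SimpleGraph V} {σ W : Finset V}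
    (hadj : ∀ u ∈ σ, ∀ v ∈ σ, part u = part v → u ∈ P → v ∉ P → G.Adj u v)
    (hW : W ⊆ σ) (hcard : W.card = r + 1) (hind : ∀ a ∈ W, ∀ b ∈ W, ¬ G.Adj a b) :
    koszulD (fun _ => (1 : K)) (transversalCochain K part P) W = 0 := by
  classical
  by_cases hex : ∃ v ∈ W, ((W.erase v : Finset V) : Set V) ⊆ P ∧ Set.InjOn part (W.erase v)
  · obtain ⟨v, hv, hP, hinj⟩ := hex
    have hsurj : (W.erase v).image part = Finset.univ := by
      rw [← Finset.card_eq_iff_eq_univ, Finset.card_image_of_injOn hinj,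
        Finset.card_erase_of_mem hv, hcard, Fintype.card_fin]
      rfl
    obtain ⟨u, hu, huv⟩ := Finset.mem_image.1 (hsurj ▸ Finset.mem_univ (part v))
    have huW := Finset.mem_of_mem_erase hu
    have hne := Finset.ne_of_mem_erase hu
    have hvP : v ∈ P := by
      by_contra hvP
      exact hind u huW v hv (hadj u (hW huW) v (hW hv) huv (hP hu) hvP)
    have hWP : (W : Set V) ⊆ P := fun x hx => by
      rcases eq_or_ne x v with rfl | hxv
      · exact hvP
      · exact hP (Finset.mem_coe.2 (Finset.mem_erase.2 ⟨hxv, hx⟩))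
    have H : ∀ x ∈ W, ∀ y ∈ W, part x = part y → x = y ∨ (x = u ∧ y = v) ∨ (x = v ∧ y = u) := by
      have hinj' : ∀ x ∈ W, ∀ y ∈ W, x ≠ v → y ≠ v → part x = part y → x = y :=
        fun x hx y hy hxv hyv h => hinj (by simp [hx, hxv]) (by simp [hy, hyv]) h
      grind
    -- Two faces `W \ {x}` carry the value `1`, and they cancel: `u` and `v` are neighbours in the
    -- order on `W`, because `part` is monotone.
    rcases lt_or_gt_of_ne hne with h | h
    · exact koszulD_transversalCochain_of_lt hmono hWP huW hv h huv H
    · exact koszulD_transversalCochain_of_lt hmono hWP hv huW h huv.symm fun x hx y hy hxy =>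
        (H x hx y hy hxy).imp_right Or.symm
  · push Not at hex
    refine Finset.sum_eq_zero fun v hv => ?_
    rw [transversalCochain, if_neg fun h => hex v hv h.1 h.2, smul_zero, smul_zero]

/-- The set of vertices of a facet of the cross-polytope with vertices `pt k true`, `pt k false`. -/
def facet (pt : Fin r → Bool → V) (c : Fin r → Bool) : Finset V :=
  Finset.univ.image fun k => pt k (c k)

/-- The sign of a facet in the fundamental cycle of the cross-polytope. -/
def facetSign (c : Fin r → Bool) : ℤ := ∏ k, if c k then 1 else -1

lemma facetSign_update_not (c : Fin r → Bool) (k : Fin r) :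
    facetSign (Function.update c k (!c k)) = -facetSign c := by
  rw [facetSign, facetSign, ← Finset.mul_prod_erase _ _ (Finset.mem_univ k),
    ← Finset.mul_prod_erase _ (fun l => if c l then (1 : ℤ) else -1) (Finset.mem_univ k),
    Finset.prod_congr rfl (g := fun l => if c l then (1 : ℤ) else -1), ← neg_mul]
  · cases c k <;> simp
  · intro l hl
    rw [Function.update_of_ne (Finset.ne_of_mem_erase hl)]

variable {part : V → Fin r} {pt : Fin r → Bool → V}

omit [LinearOrder V] in
lemma injective_of_part (hpt : ∀ k s, part (pt k s) = k) (c : Fin r → Bool) :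
    Function.Injective fun k => pt k (c k) := fun k l h => by
  have := congrArg part h
  simpa [hpt] using this

lemma card_facet (hpt : ∀ k s, part (pt k s) = k) (c : Fin r → Bool) : (facet pt c).card = r := by
  rw [facet, Finset.card_image_of_injective _ (injective_of_part hpt c), Finset.card_univ,
    Fintype.card_fin]

lemma facet_erase (hpt : ∀ k s, part (pt k s) = k) (c : Fin r → Bool) (k : Fin r) :
    (facet pt c).erase (pt k (c k)) = (Finset.univ.erase k).image fun l => pt l (c l) := by
  rw [facet, Finset.image_erase (injective_of_part hpt c)]

lemma facet_erase_update (hpt : ∀ k s, part (pt k s) = k) (c : Fin r → Bool) (k : Fin r)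
    (s : Bool) :
    (facet pt (Function.update c k s)).erase (pt k s) = (facet pt c).erase (pt k (c k)) := by
  have h := facet_erase hpt (Function.update c k s) k
  rw [Function.update_self] at h
  rw [h, facet_erase hpt]
  refine Finset.image_congr fun l hl => ?_
  rw [Function.update_of_ne (Finset.ne_of_mem_erase (Finset.mem_coe.1 hl))]

lemma insertSign_facet_erase (hmono : Monotone part) (hpt : ∀ k s, part (pt k s) = k)
    (c : Fin r → Bool) (k : Fin r) (s t : Bool) :
    insertSign ((facet pt c).erase (pt k (c k))) (pt k s) =
      insertSign ((facet pt c).erase (pt k (c k))) (pt k t) := by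
  have key : ∀ l, l ≠ k → ∀ s', pt l (c l) < pt k s' ↔ l < k := by
    intro l hl s'
    constructor
    · intro h
      have := hmono h.le
      rw [hpt, hpt] at this
      exact lt_of_le_of_ne this hl
    · intro h
      by_contra hle
      have := hmono (not_lt.1 hle)
      rw [hpt, hpt] at this
      exact absurd h (not_lt.2 this)
  rw [insertSign, insertSign]
  congr 2
  refine Finset.filter_congr fun x hx => ?_
  rw [facet_erase hpt] at hx
  obtain ⟨l, hl, rfl⟩ := Finset.mem_image.1 hx
  rw [key l (Finset.ne_of_mem_erase hl), key l (Finset.ne_of_mem_erase hl)]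

/-- The fundamental chain of the cross-polytope is a cycle, that is, it kills coboundaries. -/
lemma sum_facetSign_koszulD (hmono : Monotone part) (hpt : ∀ k s, part (pt k s) = k)
    (κ : Finset V → K) :
    ∑ c, facetSign c • koszulD (fun _ => (1 : K)) κ (facet pt c) = 0 := by
  have h : ∀ c, facetSign c • koszulD (fun _ => (1 : K)) κ (facet pt c) =
      ∑ k, facetSign c • insertSign ((facet pt c).erase (pt k (c k))) (pt k (c k)) •
        κ ((facet pt c).erase (pt k (c k))) := by
    intro c
    rw [koszulD, Finset.smul_sum]
    conv_lhs => rw [facet, Finset.sum_image fun k _ l _ h => injective_of_part hpt c h]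
    refine Finset.sum_congr rfl fun k _ => ?_
    rw [one_smul]
    rfl
  rw [Finset.sum_congr rfl fun c _ => h c, Finset.sum_comm]
  refine Finset.sum_eq_zero fun k _ => ?_
  -- The two facets through a ridge, which differ in the choice at `k`, have opposite signs.
  refine Finset.sum_ninvolution (fun c => Function.update c k (!c k)) ?_ ?_ ?_ ?_
  · intro c
    rw [Function.update_self, facet_erase_update hpt, facetSign_update_not,
      insertSign_facet_erase hmono hpt c k (!c k) (c k), neg_smul, add_neg_cancel]
  · intro c _ h
    have := congrFun h k
    rw [Function.update_self] at this
    cases hc : c k <;> simp [hc] at this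
  · exact fun c => Finset.mem_univ _
  · intro c
    simp

lemma transversalCochain_facet (hpt : ∀ k s, part (pt k s) = k) {P : Set V}
    (hP : ∀ k s, pt k s ∈ P ↔ s = true) (c : Fin r → Bool) :
    transversalCochain K part P (facet pt c) = if c = fun _ => true then 1 else 0 := by
  classical
  rw [transversalCochain]
  refine if_congr ?_ rfl rfl
  constructor
  · rintro ⟨h, -⟩
    funext k
    exact (hP k (c k)).1 (h (Finset.mem_coe.2 (Finset.mem_image_of_mem _ (Finset.mem_univ k))))
  · rintro rfl
    refine ⟨fun x hx => ?_, fun x hx y hy hxy => ?_⟩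
    · obtain ⟨k, -, rfl⟩ := Finset.mem_image.1 (Finset.mem_coe.1 hx)
      exact (hP k true).2 rfl
    · obtain ⟨k, -, rfl⟩ := Finset.mem_image.1 (Finset.mem_coe.1 hx)
      obtain ⟨l, -, rfl⟩ := Finset.mem_image.1 (Finset.mem_coe.1 hy)
      simp only [hpt] at hxy
      rw [hxy]

/-- The transversal cochain has value `1` on the fundamental cycle, so it is not a coboundary. -/
lemma exists_transversalCochain_ne (hmono : Monotone part) (hpt : ∀ k s, part (pt k s) = k)
    {P : Set V} (hP : ∀ k s, pt k s ∈ P ↔ s = true) (κ : Finset V → K) :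
    ∃ c, transversalCochain K part P (facet pt c) ≠
      koszulD (fun _ => (1 : K)) κ (facet pt c) := by
  by_contra! h
  have h0 := sum_facetSign_koszulD hmono hpt κ
  simp only [← h, transversalCochain_facet hpt hP] at h0
  rw [Finset.sum_eq_single fun _ => true] at h0
  · simp [facetSign] at h0
  · intro c _ hc
    rw [if_neg hc, smul_zero]
  · exact fun h => absurd (Finset.mem_univ _) h

end CrossPolytope

/-! ### Complete bipartite subgraphs with 3-disjoint edges -/

section Graph

variable {V : Type u} {G : SimpleGraph V}

lemma ThreeDisjoint.not_adj {e₁ e₂ : Sym2 V} (h : ThreeDisjoint G e₁ e₂) {x y : V} (hx : x ∈ e₁)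
    (hy : y ∈ e₂) : ¬ G.Adj x y := by
  intro hxy
  have hmem : s(x, y) ∈ ((⊤ : G.Subgraph).induce ((e₁ : Set V) ∪ (e₂ : Set V))).edgeSet := by
    rw [SimpleGraph.Subgraph.mem_edgeSet, SimpleGraph.Subgraph.induce_adj]
    exact ⟨Or.inl hx, Or.inr hy, hxy⟩
  rw [h.2] at hmem
  rcases hmem with hmem | hmem
  · exact Set.disjoint_left.1 h.1 (show y ∈ e₁ from hmem ▸ Sym2.mem_mk_right x y) hy
  · exact Set.disjoint_left.1 h.1 hx
      (show x ∈ e₂ from Set.mem_singleton_iff.1 hmem ▸ Sym2.mem_mk_left x y)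

/-- Every finite set mapped to `Fin r` has a linear order in which the fibres are consecutive. -/
lemma exists_linearOrder_monotone [Finite V] {r : ℕ} (part : V → Fin r) :
    ∃ _ : LinearOrder V, Monotone part := by
  obtain ⟨n, ⟨e⟩⟩ := Finite.exists_equiv_fin V
  let key : V → Fin r ×ₗ Fin n := fun v => toLex (part v, e v)
  have hkey : Function.Injective key := fun u v h => e.injective (congrArg Prod.snd h)
  refine ⟨LinearOrder.lift' key hkey, fun u v h => ?_⟩
  have h' : key u ≤ key v := h
  rcases Prod.Lex.le_iff.1 h' with h'' | h''
  · exact le_of_lt h''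
  · exact le_of_eq h''.1

end Graph

end BettiEdgeIdeal

open BettiEdgeIdeal in
theorem theorem1p1 {V : Type*} [Fintype V] (G : SimpleGraph V) (K : Type*) [Field K]
    (r : ℕ) (hr : 1 ≤ r) (B : Fin r → G.Subgraph)
    (hB : ∀ k, BettiEdgeIdeal.IsCompleteBipartiteSubgraph (B k))
    (hdisj : ∀ k l, k ≠ l → Disjoint (B k).verts (B l).verts)
    (hedges : ∃ e : Fin r → Sym2 V, (∀ k, e k ∈ (B k).edgeSet) ∧
      ∀ k l, k ≠ l → BettiEdgeIdeal.ThreeDisjoint G (e k) (e l))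
    (σ : Finset V) (hσ : (σ : Set V) = ⋃ k, (B k).verts) :
    BettiEdgeIdeal.multigradedBetti
      (BettiEdgeIdeal.quotientDegreePart (BettiEdgeIdeal.edgeIdeal K G))
      (σ.card - r) (BettiEdgeIdeal.zeroOneVector σ) ≠ 0 := by
  classical
  obtain ⟨e, he, h3⟩ := hedges
  choose V₁ V₂ hV hunion hBadj using hB
  have hends : ∀ k, ∃ a b, a ∈ V₁ k ∧ b ∈ V₂ k ∧ e k = s(a, b) := by
    intro k
    have hk := he k
    induction h : e k with
    | _ a b =>
      rw [h, SimpleGraph.Subgraph.mem_edgeSet, hBadj] at hk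
      rcases hk with ⟨ha, hb⟩ | ⟨ha, hb⟩
      · exact ⟨a, b, ha, hb, rfl⟩
      · exact ⟨b, a, hb, ha, Sym2.eq_swap⟩
  choose a b ha hb hab using hends
  have hverts : ∀ k v, v ∈ (B k).verts ↔ v ∈ V₁ k ∨ v ∈ V₂ k := fun k v => by
    rw [← hunion k]; rfl
  have hmemσ : ∀ v, v ∈ σ ↔ ∃ k, v ∈ (B k).verts := fun v => by
    rw [← Finset.mem_coe, hσ, Set.mem_iUnion]
  -- `part v` is the index of the subgraph that contains `v`; its value off `σ` plays no role.
  have hpart : ∃ part : V → Fin r, ∀ k, ∀ v ∈ (B k).verts, part v = k := by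
    refine ⟨fun v => if h : ∃ k, v ∈ (B k).verts then h.choose else ⟨0, hr⟩, fun k v hv => ?_⟩
    have hex : ∃ k, v ∈ (B k).verts := ⟨k, hv⟩
    refine (dif_pos hex).trans ?_
    by_contra hne
    exact Set.disjoint_left.1 (hdisj _ _ hne) hex.choose_spec hv
  obtain ⟨part, hpart⟩ := hpart
  obtain ⟨_, hmono⟩ := exists_linearOrder_monotone part
  let P : Set V := ⋃ k, V₁ k
  let pt : Fin r → Bool → V := fun k s => if s then a k else b k
  have hptv : ∀ k s, pt k s ∈ (B k).verts := fun k s => by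
    rw [hverts]
    cases s
    exacts [Or.inr (hb k), Or.inl (ha k)]
  have hpt : ∀ k s, part (pt k s) = k := fun k s => hpart k _ (hptv k s)
  have hmemP : ∀ k v, v ∈ (B k).verts → v ∈ P → v ∈ V₁ k := by
    intro k v hv hvP
    obtain ⟨l, hl⟩ := Set.mem_iUnion.1 hvP
    rwa [← hpart k v hv, hpart l v ((hverts l v).2 (Or.inl hl))]
  have hP : ∀ k s, pt k s ∈ P ↔ s = true := by
    intro k s
    cases s
    · refine iff_of_false (fun h => ?_) (by simp)
      exact Set.disjoint_left.1 (hV k) (hmemP k _ (hptv k false) h) (hb k)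
    · exact iff_of_true (Set.mem_iUnion.2 ⟨k, ha k⟩) rfl
  have hadj : ∀ u ∈ σ, ∀ v ∈ σ, part u = part v → u ∈ P → v ∉ P → G.Adj u v := by
    intro u hu v hv huv huP hvP
    obtain ⟨k, hk⟩ := (hmemσ u).1 hu
    obtain ⟨l, hl⟩ := (hmemσ v).1 hv
    have hkl : k = l := by rw [← hpart k u hk, huv, hpart l v hl]
    subst hkl
    have hv₂ : v ∈ V₂ k := ((hverts k v).1 hl).resolve_left
      fun h => hvP (Set.mem_iUnion.2 ⟨k, h⟩)
    exact ((hBadj k u v).2 (Or.inl ⟨hmemP k u hk huP, hv₂⟩)).adj_sub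
  have hfacet : ∀ c, facet pt c ⊆ σ := fun c x hx => by
    obtain ⟨k, -, rfl⟩ := Finset.mem_image.1 hx
    exact (hmemσ _).2 ⟨k, hptv k _⟩
  have hpte : ∀ k s, pt k s ∈ e k := fun k s => by
    rw [hab k]
    cases s
    exacts [Sym2.mem_mk_right _ _, Sym2.mem_mk_left _ _]
  have hind : ∀ c, ∀ x ∈ facet pt c, ∀ y ∈ facet pt c, ¬ G.Adj x y := by
    intro c x hx y hy hxy
    obtain ⟨k, -, rfl⟩ := Finset.mem_image.1 hx
    obtain ⟨l, -, rfl⟩ := Finset.mem_image.1 hy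
    rcases eq_or_ne k l with rfl | hkl
    · exact hxy.ne rfl
    · exact (h3 k l hkl).not_adj (hpte k _) (hpte l _) hxy
  have hres : Nonempty (MinimalFreeResolution (quotientDegreePart (edgeIdeal K G))) :=
    nonempty_minimalFreeResolution _ (fun p hp m => monomial_coeff_mem_edgeIdeal hp m)
      edgeIdeal_le_span_range_X
  have hcard : r ≤ σ.card :=
    (card_facet hpt fun _ => true).symm.le.trans (Finset.card_le_card (hfacet _))
  obtain ⟨i, hi⟩ := hres.some.exists_degree_eq hcard (transversalCochain K part P)
    (fun W hW hWr hWind => koszulD_transversalCochain hmono hadj hW hWr hWind)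
    (fun κ => by
      obtain ⟨c, hc⟩ := exists_transversalCochain_ne hmono hpt hP κ
      exact ⟨facet pt c, hfacet c, card_facet hpt c, hind c, hc⟩)
  rw [multigradedBetti, dif_pos hres, MinimalFreeResolution.multiplicity]
  have : Nonempty {j // hres.some.degree (σ.card - r) j = zeroOneVector σ} := ⟨⟨i, hi⟩⟩
  exact Nat.card_pos.ne'
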